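/- A representation of a set $X$ is a surjective partial map $\delta_X:\subseteq\mathbb N^{\mathbb N}\to X$; if $\delta_X(p)=x$, then $p$ is a name of $x$. A problem $f:\subseteq X\rightrightarrows Y$ is a partial multi-valued function between represented spaces, with domain $\{x: f(x)\neq\emptyset\}$. A problem is computable if some computable partial $F:\subseteq\mathbb N^{\mathbb N}\to\mathbb N^{\mathbb N}$ maps every name of every $x\in\mathrm{dom}(f)$ to a name of an element of $f(x)$. Composition of multi-valued functions is $g\circ f(x)=\bigcup_{y\in f(x)}g(y)$ with $\mathrm{dom}(g\circ f)=\{x\in\mathrm{dom}(f): f(x)\subseteq\mathrm{dom}(g)\}$. For problems $f:\subseteq X\rightrightarrows Y$ and $g:\subseteq W\rightrightarrows Z$, write $f\leq_{\mathrm{sW}}g$ if there are computable $K:\subseteq X\rightrightarrows W$ and $H:\subseteq Z\rightrightarrows Y$ with $\emptyset\neq H\circ g\circ K(x)\subseteq f(x)$ for all $x\in\mathrm{dom}(f)$, and $f\equiv_{\mathrm{sW}}g$ if $f\leq_{\mathrm{sW}}g$ and $g\leq_{\mathrm{sW}}f$. The jump $f'$ is the same problem as $f$ with the input representation $\delta_X$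 replaced by $\delta_X\circ\lim$, where $\lim\langle p_0,p_1,p_2,\dots\rangle=\lim_{i\to\infty}p_i$ on Baire space, $\langle p_0,p_1,\dots\rangle\langle i,k\rangle=p_i(k)$, and $\langle\cdot,\cdot\rangle$ is the Cantor pairing function; $f^{(m)}$ is the $m$-fold jump. Let $2=\{0,1\}$ with the discrete topology. - $\mathsf C_2:\subseteq\mathcal A_-(2)\rightrightarrows 2$, $A\mapsto A$, is the problem of finding an element of a nonempty set $A\subseteq 2$ that is given by an enumeration of its complement. - $\mathsf{BWT}_2:2^{\mathbb N}\rightrightarrows 2$ is the problem of finding a cluster point of a sequence in $2$, where a sequence is its own name. - For $n\geq1$, a coloring $c:[\mathbb N]^n\to2$ of the $n$-element subsets of $\mathbb N$ is represented by its values along a standard numbering of $[\mathbb N]^n$. It is stable if $\lim_{i\to\infty}c(A\cup\{i\})$ exists for every $A\in[\mathbb N]^{n-1}$. $\mathsf{CSRT}_{n,2}$ maps each stable coloring $c$ to the set of all pairs $(c(M),M)\in 2\times2^{\mathbb N}$, where $M\subseteq\mathbb N$ is an infinite homogeneous set for $c$, given by its characteristic function, and $c(M)$ is the color that $c$ takes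 on all $n$-element subsets of $M$. Theorem. For all $n\geq2$, $$\mathsf C_2^{(n)}\equiv_{\mathrm{sW}}\mathsf{BWT}_2^{(n-1)}\leq_{\mathrm{sW}}\mathsf{CSRT}_{n,2};$$ in particular $\mathsf C_2^{(n)}\leq_{\mathrm{sW}}\mathsf{CSRT}_{n,2}$. -/

import Mathlib

open Filter Topology

namespace Weihrauch

/-! ### Computable functions on Baire space -/

/-- The partial recursive functionals `Φ : ℕ^ℕ × ℕ ⇀ ℕ`: the closure of the usual initial functions
and of the evaluation `(p, n) ↦ p n` of the oracle under pairing, composition, primitive recursion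
and minimisation. The oracle `p` is a parameter, so one and the same program works for all `p`. -/
inductive RecursiveFunctional : ((ℕ → ℕ) → ℕ →. ℕ) → Prop
  | zero : RecursiveFunctional fun _ _ => Part.some 0
  | succ : RecursiveFunctional fun _ n => Part.some (n + 1)
  | left : RecursiveFunctional fun _ n => Part.some (Nat.unpair n).1
  | right : RecursiveFunctional fun _ n => Part.some (Nat.unpair n).2
  | oracle : RecursiveFunctional fun p n => Part.some (p n)
  | pair {Φ Ψ : (ℕ → ℕ) → ℕ →. ℕ} (hΦ : RecursiveFunctional Φ) (hΨ : RecursiveFunctional Ψ) :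
      RecursiveFunctional fun p n => (Nat.pair <$> Φ p n <*> Ψ p n)
  | comp {Φ Ψ : (ℕ → ℕ) → ℕ →. ℕ} (hΦ : RecursiveFunctional Φ) (hΨ : RecursiveFunctional Ψ) :
      RecursiveFunctional fun p n => Ψ p n >>= Φ p
  | prec {Φ Ψ : (ℕ → ℕ) → ℕ →. ℕ} (hΦ : RecursiveFunctional Φ) (hΨ : RecursiveFunctional Ψ) :
      RecursiveFunctional fun p m =>
        let (a, n) := Nat.unpair m
        n.rec (Φ p a) fun y IH => do
          let i ← IH
          Ψ p (Nat.pair a (Nat.pair y i))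
  | rfind {Φ : (ℕ → ℕ) → ℕ →. ℕ} (hΦ : RecursiveFunctional Φ) :
      RecursiveFunctional fun p a =>
        Nat.rfind fun n => (fun m => decide (m = 0)) <$> Φ p (Nat.pair a n)

/-- A partial function `F :⊆ ℕ^ℕ → ℕ^ℕ` is computable if some program computes, with oracle `p`,
the sequence `F p`, for every `p` in the domain of `F`. -/
def ComputableOnBaire (F : (ℕ → ℕ) →. (ℕ → ℕ)) : Prop :=
  ∃ Φ, RecursiveFunctional Φ ∧ ∀ p, ∀ q ∈ F p, ∀ n, q n ∈ Φ p n

/-! ### Cantor pairing -/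

/-- The Cantor pairing `⟨n, k⟩ = (n + k + 1)(n + k) / 2 + k`. -/
def cantorPair (n k : ℕ) : ℕ := (n + k + 1) * (n + k) / 2 + k

/-- The inverse of `cantorPair`, walking through the diagonals. -/
def cantorUnpair : ℕ → ℕ × ℕ
  | 0 => (0, 0)
  | z + 1 =>
    match cantorUnpair z with
    | (0, k) => (k + 1, 0)
    | (n + 1, k) => (n, k + 1)

theorem cantorPair_zero_succ (k : ℕ) : cantorPair (k + 1) 0 = cantorPair 0 k + 1 := by
  have h : (k + 1 + 0 + 1) * (k + 1 + 0) = (0 + k + 1) * (0 + k) + (k + 1) * 2 := by ring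
  unfold cantorPair
  rw [h, Nat.add_mul_div_right _ _ (by norm_num)]
  omega

theorem cantorPair_succ_right (n k : ℕ) : cantorPair n (k + 1) = cantorPair (n + 1) k + 1 := by
  have h : n + (k + 1) = n + 1 + k := by ring
  unfold cantorPair
  rw [h]
  omega

theorem cantorPair_unpair (z : ℕ) : cantorPair (cantorUnpair z).1 (cantorUnpair z).2 = z := by
  induction z with
  | zero => rfl
  | succ z ih =>
    rw [cantorUnpair]
    rcases h : cantorUnpair z with ⟨_ | n, k⟩
    · rw [h] at ih
      simpa [cantorPair_zero_succ] using ih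
    · rw [h] at ih
      simpa [cantorPair_succ_right] using ih

theorem cantorUnpair_pair (n k : ℕ) : cantorUnpair (cantorPair n k) = (n, k) := by
  suffices H : ∀ s k n, n + k = s → cantorUnpair (cantorPair n k) = (n, k) from H _ k n rfl
  intro s
  induction s with
  | zero =>
    intro k n h
    obtain ⟨rfl, rfl⟩ : n = 0 ∧ k = 0 := by omega
    rfl
  | succ s ihs =>
    intro k
    induction k with
    | zero =>
      intro n h
      obtain rfl : n = s + 1 := by omega
      rw [cantorPair_zero_succ, cantorUnpair, ihs s 0 (by omega)]
    | succ k ihk =>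
      intro n h
      rw [cantorPair_succ_right, cantorUnpair, ihk (n + 1) (by omega)]

/-! ### Represented spaces -/

/-- A representation of `X`, i.e. a surjective partial map `δ :⊆ ℕ^ℕ → X`, given by its graph:
`IsName p x` means that `p` is in the domain of `δ` and `δ p = x`. -/
structure Representation (X : Type) where
  IsName : (ℕ → ℕ) → X → Prop
  unique : ∀ p x y, IsName p x → IsName p y → x = y
  surj : ∀ x, ∃ p, IsName p x

/-- The graph of the limit map on Baire space, `⟨p₀, p₁, p₂, …⟩ ↦ lim pᵢ`,
where `⟨p₀, p₁, …⟩⟨i, k⟩ = pᵢ k`. -/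
def IsLim (p q : ℕ → ℕ) : Prop :=
  Tendsto (fun (i : ℕ) (k : ℕ) => p (cantorPair i k)) atTop (𝓝 q)

/-- The jump `δ' = δ ∘ lim` of a representation. -/
def Representation.jump {X : Type} (δ : Representation X) : Representation X where
  IsName p x := ∃ q, IsLim p q ∧ δ.IsName q x
  unique := by
    rintro p x y ⟨q, hq, hx⟩ ⟨r, hr, hy⟩
    obtain rfl : q = r := tendsto_nhds_unique hq hr
    exact δ.unique q x y hx hy
  surj x := by
    obtain ⟨q, hq⟩ := δ.surj x
    refine ⟨fun z => q (cantorUnpair z).2, q, ?_, hq⟩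
    simp only [IsLim, cantorUnpair_pair]
    exact tendsto_const_nhds

/-- The product representation: a name of `(x, y)` interleaves names of `x` and of `y`. -/
def Representation.prod {X Y : Type} (δ : Representation X) (ε : Representation Y) :
    Representation (X × Y) where
  IsName r z := δ.IsName (fun n => r (2 * n)) z.1 ∧ ε.IsName (fun n => r (2 * n + 1)) z.2
  unique := fun _ _ _ hx hy =>
    Prod.ext (δ.unique _ _ _ hx.1 hy.1) (ε.unique _ _ _ hx.2 hy.2)
  surj := by
    rintro ⟨x, y⟩
    obtain ⟨p, hp⟩ := δ.surj x
    obtain ⟨q, hq⟩ := ε.surj y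
    refine ⟨fun n => if n % 2 = 0 then p (n / 2) else q (n / 2), ?_, ?_⟩
    · convert hp using 2 with n
      simp
    · convert hq using 2 with n
      have h1 : (2 * n + 1) % 2 = 1 := by omega
      have h2 : (2 * n + 1) / 2 = n := by omega
      simp [h1, h2]

/-- The discrete space `k = {0, …, k - 1}`: `p` is a name of `p 0`. -/
def finRep (k : ℕ) : Representation (Fin k) where
  IsName p a := p 0 = a
  unique := fun _ _ _ hx hy => Fin.ext (hx.symm.trans hy)
  surj a := ⟨fun _ => a, rfl⟩

/-- The space `k^ℕ` of sequences in `k`: each sequence is its own name. -/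
def finSeqRep (k : ℕ) : Representation (ℕ → Fin k) where
  IsName p x := ∀ i, p i = x i
  unique := fun _ _ _ hx hy => funext fun i => Fin.ext ((hx i).symm.trans (hy i))
  surj x := ⟨fun i => x i, fun _ => rfl⟩

open Classical in
/-- The space `2^ℕ` of subsets of `ℕ`, represented by characteristic functions. -/
noncomputable def setRep : Representation (Set ℕ) where
  IsName p M := ∀ i, p i = if i ∈ M then 1 else 0
  unique := fun p M N hM hN => by
    ext i
    have h := (hM i).symm.trans (hN i)
    by_cases h1 : i ∈ M <;> by_cases h2 : i ∈ N <;> simp_all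
  surj M := ⟨fun i => if i ∈ M then 1 else 0, fun _ => rfl⟩

/-- The space `𝒜₋(k)` of closed (that is, of all) subsets of the discrete space `k` with negative
information: a name of `A` enumerates the complement of `A`, where the entry `a + 1` lists the
point `a` and every entry that is not of this form lists nothing. -/
def negRep (k : ℕ) : Representation (Set (Fin k)) where
  IsName p A := ∀ a : Fin k, a ∉ A ↔ ∃ i, p i = a + 1
  unique := fun p A B hA hB => by
    ext a
    exact not_iff_not.mp ((hA a).trans (hB a).symm)
  surj A := by
    classical
    refine ⟨fun i => if h : i < k then (if (⟨i, h⟩ : Fin k) ∈ A then 0 else i + 1) else 0,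
      fun a => ⟨fun ha => ⟨a, by simp [ha]⟩, ?_⟩⟩
    rintro ⟨i, hi⟩ ha
    by_cases h : i < k
    · by_cases h' : (⟨i, h⟩ : Fin k) ∈ A
      · simp [h, h'] at hi
      · simp only [h, h', dite_true, if_false] at hi
        exact h' (by convert ha using 1; exact Fin.ext (by simpa using hi))
    · simp [h] at hi

/-! ### Colorings -/

/-- The set `[ℕ]^n` of `n`-element subsets of `ℕ`. -/
abbrev NSubset (n : ℕ) : Type := {A : Finset ℕ // A.card = n}

/-- The standard numbering of `[ℕ]^n`, for `n ≥ 1`: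
`⟨i₀, …, i_{n-1}⟩ ↦ {i₀ < i₀ + i₁ + 1 < i₀ + i₁ + i₂ + 2 < ⋯}`,
where `⟨i₀, i₁, …, i_{n-1}⟩ = ⟨i₀, ⟨i₁, …, i_{n-1}⟩⟩`. -/
def theta : ℕ → ℕ → Finset ℕ
  | 0, _ => ∅
  | 1, z => {z}
  | n + 2, z =>
    insert (cantorUnpair z).1
      ((theta (n + 1) (cantorUnpair z).2).map (addRightEmbedding ((cantorUnpair z).1 + 1)))

theorem card_theta : ∀ n z, (theta n z).card = n
  | 0, _ => rfl
  | 1, _ => rfl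
  | n + 2, z => by
    rw [theta, Finset.card_insert_of_notMem, Finset.card_map, card_theta (n + 1)]
    simp only [Finset.mem_map, addRightEmbedding_apply, not_exists, not_and]
    intro x _
    omega

theorem theta_surjective : ∀ n (A : Finset ℕ), A.card = n → ∃ z, theta n z = A
  | 0, A, h => ⟨0, (Finset.card_eq_zero.mp h).symm⟩
  | 1, A, h => by
    obtain ⟨a, rfl⟩ := Finset.card_eq_one.mp h
    exact ⟨a, rfl⟩
  | n + 2, A, h => by
    have hne : A.Nonempty := Finset.card_pos.mp (by omega)
    set a := A.min' hne with ha
    have haA : a ∈ A := A.min'_mem hne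
    have hlt : ∀ x ∈ A.erase a, a + 1 ≤ x := fun x hx =>
      lt_of_le_of_ne (A.min'_le x (Finset.mem_of_mem_erase hx)) (Finset.ne_of_mem_erase hx).symm
    obtain ⟨z, hz⟩ := theta_surjective (n + 1) ((A.erase a).image (· - (a + 1))) (by
      rw [Finset.card_image_of_injOn, Finset.card_erase_of_mem haA, h]
      · rfl
      · intro x hx y hy hxy
        have := hlt x hx
        have := hlt y hy
        simp only at hxy
        omega)
    refine ⟨cantorPair a z, ?_⟩
    rw [theta, cantorUnpair_pair, hz]
    have : ((A.erase a).image (· - (a + 1))).map (addRightEmbedding (a + 1)) = A.erase a := by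
      ext x
      simp only [Finset.mem_map, Finset.mem_image, addRightEmbedding_apply]
      constructor
      · rintro ⟨_, ⟨y, hy, rfl⟩, rfl⟩
        rwa [Nat.sub_add_cancel (hlt y hy)]
      · intro hx
        exact ⟨_, ⟨x, hx, rfl⟩, Nat.sub_add_cancel (hlt x hx)⟩
    simp only [this]
    exact Finset.insert_erase haA

/-- The space `𝒞_{n,k}` of colorings `c : [ℕ]^n → k`: `p` is a name of `c` if `p i = c (ϑ_n i)`. -/
def coloringRep (n k : ℕ) : Representation (NSubset n → Fin k) where
  IsName p c := ∀ i, p i = c ⟨theta n i, card_theta n i⟩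
  unique := by
    intro p c d hc hd
    funext ⟨A, hA⟩
    obtain ⟨z, rfl⟩ := theta_surjective n A hA
    exact Fin.ext ((hc z).symm.trans (hd z))
  surj c := ⟨fun i => c ⟨theta n i, card_theta n i⟩, fun _ => rfl⟩

/-- A coloring `c` of `[ℕ]^n` is stable if `lim_{i → ∞} c (A ∪ {i})` exists for all `(n-1)`-element
sets `A`; here `c (A ∪ {i})` makes sense for all `i ∉ A`. -/
def IsStable {n k : ℕ} (c : NSubset n → Fin k) : Prop :=
  ∀ A : Finset ℕ, A.card + 1 = n →
    ∃ a, ∀ᶠ i in atTop, ∀ h : (insert i A).card = n, c ⟨insert i A, h⟩ = a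

/-- `M` is an infinite homogeneous set for `c`, of color `c(M) = a`. -/
def IsHomogeneousOfColor {n k : ℕ} (c : NSubset n → Fin k) (a : Fin k) (M : Set ℕ) : Prop :=
  M.Infinite ∧ ∀ A : NSubset n, (A.1 : Set ℕ) ⊆ M → c A = a

/-! ### Problems and strong Weihrauch reducibility -/

/-- The domain of a partial multi-valued function. -/
def mdom {X Y : Type} (f : X → Set Y) : Set X := {x | (f x).Nonempty}

/-- The composition `g ∘ f` of partial multi-valued functions; its domain consists of those
`x ∈ dom f` with `f x ⊆ dom g`. -/
def mcomp {X Y Z : Type} (g : Y → Set Z) (f : X → Set Y) : X → Set Z :=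
  fun x => {z | f x ⊆ mdom g ∧ ∃ y ∈ f x, z ∈ g y}

/-- `F ⊢ f`: the partial function `F` on Baire space realizes `f`. -/
def Realizes {X Y : Type} (δX : Representation X) (δY : Representation Y)
    (F : (ℕ → ℕ) →. (ℕ → ℕ)) (f : X → Set Y) : Prop :=
  ∀ p x, δX.IsName p x → x ∈ mdom f → ∃ q ∈ F p, ∃ y ∈ f x, δY.IsName q y

/-- A partial multi-valued function on represented spaces is computable if it has a computable
realizer. -/
def ComputableMulti {X Y : Type} (δX : Representation X) (δY : Representation Y)
    (f : X → Set Y) : Prop :=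
  ∃ F, ComputableOnBaire F ∧ Realizes δX δY F f

/-- A problem: a partial multi-valued function on represented spaces. -/
structure Problem where
  In : Type
  Out : Type
  inRep : Representation In
  outRep : Representation Out
  sol : In → Set Out

/-- Strong Weihrauch reducibility: there are computable `K :⊆ X ⇉ W` and `H :⊆ Z ⇉ Y` with
`∅ ≠ H g K x ⊆ f x` for all `x ∈ dom f`. -/
def StrongLE (f g : Problem) : Prop :=
  ∃ (K : f.In → Set g.In) (H : g.Out → Set f.Out),
    ComputableMulti f.inRep g.inRep K ∧ ComputableMulti g.outRep f.outRep H ∧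
    ∀ x ∈ mdom f.sol,
      (mcomp H (mcomp g.sol K) x).Nonempty ∧ mcomp H (mcomp g.sol K) x ⊆ f.sol x

/-- Strong Weihrauch equivalence. -/
def StrongEquiv (f g : Problem) : Prop := StrongLE f g ∧ StrongLE g f

/-- The jump `f'`: the same problem, with the input representation replaced by its jump. -/
def Problem.jump (f : Problem) : Problem := { f with inRep := f.inRep.jump }

/-- The `n`-fold jump `f^(n)`. -/
def Problem.iterJump (f : Problem) (n : ℕ) : Problem :=
  { f with inRep := Representation.jump^[n] f.inRep }

theorem Problem.iterJump_zero (f : Problem) : f.iterJump 0 = f := rfl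

theorem Problem.iterJump_succ (f : Problem) (n : ℕ) :
    f.iterJump (n + 1) = (f.iterJump n).jump := by
  simp only [Problem.iterJump, Problem.jump, Function.iterate_succ_apply']

/-- Closed choice `C_k :⊆ 𝒜₋(k) ⇉ k`, `A ↦ A`. -/
def choice (k : ℕ) : Problem where
  In := Set (Fin k)
  Out := Fin k
  inRep := negRep k
  outRep := finRep k
  sol A := A

/-- The Bolzano-Weierstrass problem `BWT_k : k^ℕ ⇉ k`: the cluster points of a sequence. -/
def BWT (k : ℕ) : Problem where
  In := ℕ → Fin k
  Out := Fin k
  inRep := finSeqRep k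
  outRep := finRep k
  sol x := {a | MapClusterPt a atTop x}

/-- The colored stable Ramsey theorem `CSRT_{n,k} :⊆ 𝒞_{n,k} ⇉ k × 2^ℕ`: a stable coloring `c` is
mapped to the pairs `(c(M), M)`, with `M` an infinite homogeneous set for `c`. -/
noncomputable def CSRT (n k : ℕ) : Problem where
  In := NSubset n → Fin k
  Out := Fin k × Set ℕ
  inRep := coloringRep n k
  outRep := (finRep k).prod setRep
  sol c := {z | IsStable c ∧ IsHomogeneousOfColor c z.1 z.2}

end Weihrauch

namespace Weihrauch

/-! ### Total computable functionals -/

/-! Everything rests on three reductions, each given by total maps on names.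

`C₂' ≤ BWT₂`: a name of a nonempty `A ⊆ 2` is now only approximated. At each stage, output the point
whose exclusion shows up later in the current approximation. If one point is really excluded, the
other never is, so eventually only the right point is output.

`BWT₂ ≤ C₂'`: that `a` is not a cluster point means that some tail avoids `a`. For each tail this is
a limit of decidable guesses that change at most once, so the complement of the set of cluster
points is enumerated in the limit.

Both forward maps are `Finitary`. Applied row by row they commute with limits, so both reductions
lift through all jumps (`ReducesVia.iterJump`) with the same backward map.

`BWT₂^(n-1) ≤ CSRT_{n,2}`: the input is an iterated limit. Color `{k < s₁ < … < sₘ}` by the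
approximation to entry `k` with limit indices `s₁, …, sₘ`, the largest element being the outermost
index. The outermost limit makes the coloring stable. On an infinite homogeneous set, letting the
elements tend to infinity one after the other shows that its color is that of entry `k` for every
`k` in the set (`toColor_of_homogeneous`), hence a cluster point. Conversely, a homogeneous set for
any cluster point is built by a maximality argument (`exists_homogeneous`), so the coloring has a
solution. -/

/-- The total functional `F` is computable. -/
def TotalRecursive (F : (ℕ → ℕ) → ℕ → ℕ) : Prop :=
  RecursiveFunctional fun p n => Part.some (F p n)

namespace TotalRecursive

variable {F G : (ℕ → ℕ) → ℕ → ℕ}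

theorem pair (hF : TotalRecursive F) (hG : TotalRecursive G) :
    TotalRecursive fun p n => Nat.pair (F p n) (G p n) := by
  have h := RecursiveFunctional.pair hF hG
  simpa [TotalRecursive, Seq.seq] using h

theorem comp (hF : TotalRecursive F) (hG : TotalRecursive G) :
    TotalRecursive fun p n => F p (G p n) := by
  have h := RecursiveFunctional.comp hF hG
  simpa [TotalRecursive] using h

theorem prec (hF : TotalRecursive F) (hG : TotalRecursive G) :
    TotalRecursive fun p m => Nat.rec (F p m.unpair.1)
      (fun y i => G p (Nat.pair m.unpair.1 (Nat.pair y i))) m.unpair.2 := by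
  have h := RecursiveFunctional.prec hF hG
  refine (congrArg RecursiveFunctional (funext₂ fun p m => ?_)).mpr h
  dsimp only
  induction m.unpair.2 with
  | zero => rfl
  | succ k ih =>
    dsimp only
    rw [← ih]
    exact (Part.bind_some _ _).symm

theorem of_natPrimrec {f : ℕ → ℕ} (hf : Nat.Primrec f) : TotalRecursive fun _ n => f n := by
  induction hf with
  | zero => exact RecursiveFunctional.zero
  | succ => exact RecursiveFunctional.succ
  | left => exact RecursiveFunctional.left
  | right => exact RecursiveFunctional.right
  | pair _ _ ihf ihg => exact ihf.pair ihg
  | comp _ _ ihf ihg => exact ihf.comp ihg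
  | prec _ _ ihf ihg => exact ihf.prec ihg

theorem of_primrec {f : ℕ → ℕ} (hf : Primrec f) : TotalRecursive fun _ n => f n :=
  of_natPrimrec (Primrec.nat_iff.mp hf)

theorem oracle : TotalRecursive fun p n => p n :=
  RecursiveFunctional.oracle

end TotalRecursive

/-- Substituting a total computable functional for the oracle. -/
theorem RecursiveFunctional.subst {Φ : (ℕ → ℕ) → ℕ →. ℕ} (hΦ : RecursiveFunctional Φ)
    {F : (ℕ → ℕ) → ℕ → ℕ} (hF : TotalRecursive F) : RecursiveFunctional fun p => Φ (F p) := by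
  induction hΦ with
  | zero => exact .zero
  | succ => exact .succ
  | left => exact .left
  | right => exact .right
  | oracle => exact hF
  | pair _ _ ih₁ ih₂ => exact .pair ih₁ ih₂
  | comp _ _ ih₁ ih₂ => exact .comp ih₁ ih₂
  | prec _ _ ih₁ ih₂ => exact .prec ih₁ ih₂
  | rfind _ ih => exact .rfind ih

theorem TotalRecursive.subst {F G : (ℕ → ℕ) → ℕ → ℕ} (hG : TotalRecursive G)
    (hF : TotalRecursive F) : TotalRecursive fun p => G (F p) :=
  RecursiveFunctional.subst hG hF

/-- The code of the list of the first `n` values of the oracle. -/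
theorem totalRecursive_initialSegment :
    TotalRecursive fun p n => Encodable.encode ((List.range n).map p) := by
  -- In the recursion `m` codes `(a, (y, i))`: `y` is the current length and `i` the code of the
  -- list so far, to which `p y` is appended.
  have hstep : TotalRecursive fun p m => Encodable.encode
      ((Denumerable.ofNat (List ℕ) m.unpair.2.unpair.2) ++ [p m.unpair.2.unpair.1]) := by
    have h₁ : Primrec fun m : ℕ => Encodable.encode
        ((Denumerable.ofNat (List ℕ) m.unpair.1) ++ [m.unpair.2]) :=
      Primrec.encode.comp (Primrec.list_concat.comp
        ((Primrec.ofNat _).comp (Primrec.fst.comp Primrec.unpair))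
        (Primrec.snd.comp Primrec.unpair))
    have hy : Primrec fun m : ℕ => m.unpair.2.unpair.1 :=
      Primrec.fst.comp (Primrec.unpair.comp (Primrec.snd.comp Primrec.unpair))
    have hi : Primrec fun m : ℕ => m.unpair.2.unpair.2 :=
      Primrec.snd.comp (Primrec.unpair.comp (Primrec.snd.comp Primrec.unpair))
    have h := (TotalRecursive.of_primrec h₁).comp ((TotalRecursive.of_primrec hi).pair
      (TotalRecursive.oracle.comp (TotalRecursive.of_primrec hy)))
    simpa using h
  have h := ((TotalRecursive.of_primrec
      (Primrec.const (Encodable.encode ([] : List ℕ)))).prec hstep).comp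
    ((TotalRecursive.of_primrec (Primrec.const 0)).pair (TotalRecursive.of_primrec Primrec.id))
  convert h using 3 with p n
  simp only [Nat.unpair_pair, id]
  induction n with
  | zero => rfl
  | succ k ih =>
    rw [List.range_succ, List.map_append]
    simp only [← ih, Denumerable.ofNat_encode, List.map_cons, List.map_nil]

/-- The functional `F` is primitive recursive with a primitive recursive bound on the part of the
oracle that it uses. -/
def Finitary (F : (ℕ → ℕ) → ℕ → ℕ) : Prop :=
  ∃ (b : ℕ → ℕ) (f : ℕ → List ℕ → ℕ), Primrec b ∧ Primrec₂ f ∧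
    ∀ p n, F p n = f n ((List.range (b n)).map p)

theorem Finitary.totalRecursive {F : (ℕ → ℕ) → ℕ → ℕ} (hF : Finitary F) : TotalRecursive F := by
  obtain ⟨b, f, hb, hf, h⟩ := hF
  have h₁ : Primrec fun m : ℕ => f m.unpair.1 (Denumerable.ofNat (List ℕ) m.unpair.2) :=
    hf.comp (Primrec.fst.comp Primrec.unpair)
      ((Primrec.ofNat _).comp (Primrec.snd.comp Primrec.unpair))
  have h₂ := (TotalRecursive.of_primrec h₁).comp ((TotalRecursive.of_primrec Primrec.id).pair
    (totalRecursive_initialSegment.comp (TotalRecursive.of_primrec hb)))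
  convert h₂ using 3 with p n
  simp [h]

/-! ### Primitive recursiveness of the Cantor pairing -/

theorem primrec_cantorPair : Primrec₂ cantorPair := by
  have hs : Primrec₂ fun n k : ℕ => n + k := Primrec.nat_add
  exact Primrec.nat_add.comp₂
    (Primrec.nat_div.comp₂ (Primrec.nat_mul.comp₂ (Primrec.succ.comp₂ hs) hs)
      (Primrec₂.const 2)) Primrec₂.right

theorem primrec_cantorUnpair : Primrec cantorUnpair := by
  -- One step of the walk through the diagonals; `cantorUnpair z` is its `z`-th iterate from `(0,
  -- 0)`.
  have hstep : Primrec fun x : ℕ × ℕ => if x.1 = 0 then (x.2 + 1, 0) else (x.1 - 1, x.2 + 1) :=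
    Primrec.ite (Primrec.eq.comp Primrec.fst (Primrec.const 0))
      (Primrec.pair (Primrec.succ.comp Primrec.snd) (Primrec.const 0))
      (Primrec.pair (Primrec.pred.comp Primrec.fst) (Primrec.succ.comp Primrec.snd))
  refine (Primrec.nat_iterate Primrec.id (Primrec.const (0, 0)) (hstep.comp₂ Primrec₂.right)).of_eq
    fun z => ?_
  simp only [id]
  induction z with
  | zero => rfl
  | succ z ih =>
    rw [Function.iterate_succ_apply', ih, cantorUnpair]
    rcases cantorUnpair z with ⟨_ | n, k⟩ <;> simp

/-- Bounds oracle use: the first `l` entries of row `i` all lie below position `cantorPair i l`. -/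
theorem cantorPair_lt_cantorPair (i : ℕ) {k l : ℕ} (h : k < l) :
    cantorPair i k < cantorPair i l := by
  unfold cantorPair
  have : (i + k + 1) * (i + k) / 2 ≤ (i + l + 1) * (i + l) / 2 :=
    Nat.div_le_div_right (Nat.mul_le_mul (by omega) (by omega))
  omega

/-! ### Limits -/

theorem isLim_iff {p q : ℕ → ℕ} :
    IsLim p q ↔ ∀ k, ∀ᶠ i in atTop, p (cantorPair i k) = q k := by
  simp [IsLim, tendsto_pi_nhds, nhds_discrete]

/-- The action of `F` on sequences of points of Baire space. -/
def pointwise (F : (ℕ → ℕ) → ℕ → ℕ) (p : ℕ → ℕ) (z : ℕ) : ℕ :=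
  F (fun k => p (cantorPair (cantorUnpair z).1 k)) (cantorUnpair z).2

/-- Finite use is continuity: once row `i` of `p` agrees with `q` on the first `b n` entries, the
values at `n` agree. -/
theorem Finitary.isLim {F : (ℕ → ℕ) → ℕ → ℕ} (hF : Finitary F) {p q : ℕ → ℕ} (h : IsLim p q) :
    IsLim (pointwise F p) (F q) := by
  obtain ⟨b, f, -, -, hf⟩ := hF
  rw [isLim_iff] at h ⊢
  intro n
  have h' : ∀ᶠ i in atTop, ∀ k ∈ Finset.range (b n), p (cantorPair i k) = q k :=
    (Filter.eventually_all_finset _).mpr fun k _ => h k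
  filter_upwards [h'] with i hi
  simp only [pointwise, cantorUnpair_pair, hf]
  congr 1
  exact List.map_congr_left fun k hk => hi k (by simpa using hk)

theorem Finitary.pointwise {F : (ℕ → ℕ) → ℕ → ℕ} (hF : Finitary F) : Finitary (pointwise F) := by
  obtain ⟨b, f, hb, hf, h⟩ := hF
  have h₁ : Primrec fun z => (cantorUnpair z).1 := Primrec.fst.comp primrec_cantorUnpair
  have h₂ : Primrec fun z => (cantorUnpair z).2 := Primrec.snd.comp primrec_cantorUnpair
  refine ⟨fun z => cantorPair (cantorUnpair z).1 (b (cantorUnpair z).2),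
    fun z l => f (cantorUnpair z).2 ((List.range (b (cantorUnpair z).2)).map
      fun k => l.getD (cantorPair (cantorUnpair z).1 k) 0),
    primrec_cantorPair.comp h₁ (hb.comp h₂), ?_, fun p z => ?_⟩
  · exact hf.comp (h₂.comp Primrec.fst) (Primrec.list_map
      (Primrec.list_range.comp (hb.comp (h₂.comp Primrec.fst)))
      ((Primrec.list_getD 0).comp (Primrec.snd.comp Primrec.fst)
        (primrec_cantorPair.comp (h₁.comp (Primrec.fst.comp Primrec.fst)) Primrec.snd)).to₂)
  · simp only [Weihrauch.pointwise, h]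
    congr 1
    refine List.map_congr_left fun k hk => ?_
    have := cantorPair_lt_cantorPair (cantorUnpair z).1 (List.mem_range.mp hk)
    simp [List.getD, this]

/-! ### Reductions by total computable functionals -/

/-- `F` and `G` are total forward and backward maps of a strong Weihrauch reduction. -/
def ReducesVia (f g : Problem) (F G : (ℕ → ℕ) → ℕ → ℕ) : Prop :=
  ∀ p x, f.inRep.IsName p x → x ∈ mdom f.sol →
    ∃ w, g.inRep.IsName (F p) w ∧ w ∈ mdom g.sol ∧
      ∀ z ∈ g.sol w, ∀ q, g.outRep.IsName q z → ∃ y ∈ f.sol x, f.outRep.IsName (G q) y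

theorem computableOnBaire_of_total {F : (ℕ → ℕ) → ℕ → ℕ} (hF : TotalRecursive F) :
    ComputableOnBaire fun p => Part.some (F p) :=
  ⟨_, hF, fun p q hq n => by simp [Part.mem_some_iff.mp hq]⟩

/-- Maps on names induce multi-valued `K` and `H` by letting the name vary. Uniqueness of the point
named makes the result independent of the name of `w` or `y` at hand. -/
theorem ReducesVia.strongLE {f g : Problem} {F G : (ℕ → ℕ) → ℕ → ℕ} (h : ReducesVia f g F G)
    (hF : TotalRecursive F) (hG : TotalRecursive G) : StrongLE f g := by
  have key : ∀ x ∈ mdom f.sol, ∀ p, f.inRep.IsName p x → ∀ w, g.inRep.IsName (F p) w →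
      w ∈ mdom g.sol ∧ ∀ z ∈ g.sol w, ∀ q, g.outRep.IsName q z →
        ∃ y ∈ f.sol x, f.outRep.IsName (G q) y := by
    intro x hx p hp w hw
    obtain ⟨w', hw', h'⟩ := h p x hp hx
    obtain rfl := g.inRep.unique _ _ _ hw hw'
    exact h'
  refine ⟨fun x => {w | x ∈ mdom f.sol ∧ ∃ p, f.inRep.IsName p x ∧ g.inRep.IsName (F p) w},
    -- The first clause cuts the domain of `H` down to the points all of whose names `G` sends to
    -- names, as a realizer must succeed on every name.
    fun z => {y | (∀ q, g.outRep.IsName q z → ∃ y', f.outRep.IsName (G q) y') ∧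
      ∃ q, g.outRep.IsName q z ∧ f.outRep.IsName (G q) y},
    ⟨_, computableOnBaire_of_total hF, ?_⟩, ⟨_, computableOnBaire_of_total hG, ?_⟩,
    fun x hx => ⟨?_, ?_⟩⟩
  · rintro p x hp ⟨-, hx, -⟩
    obtain ⟨w, hw, -⟩ := h p x hp hx
    exact ⟨F p, Part.mem_some _, w, ⟨hx, p, hp, hw⟩, hw⟩
  · rintro q z hq ⟨-, hz, -⟩
    obtain ⟨y, hy⟩ := hz q hq
    exact ⟨G q, Part.mem_some _, y, ⟨hz, q, hq, hy⟩, hy⟩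
  · obtain ⟨p, hp⟩ := f.inRep.surj x
    obtain ⟨w, hw, ⟨z, hz⟩, hG'⟩ := h p x hp hx
    obtain ⟨q, hq⟩ := g.outRep.surj z
    obtain ⟨y, -, hy⟩ := hG' z hz q hq
    refine ⟨y, ?_, z, ⟨?_, w, ⟨hx, p, hp, hw⟩, hz⟩, ?_, q, hq, hy⟩
    · rintro z' ⟨-, w', ⟨-, p', hp', hw'⟩, hz'⟩
      have hall := (key x hx p' hp' w' hw').2 z' hz'
      obtain ⟨q', hq'⟩ := g.outRep.surj z'
      obtain ⟨y', -, hy'⟩ := hall q' hq'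
      exact ⟨y', fun r hr => (hall r hr).imp fun _ => And.right, q', hq', hy'⟩
    · rintro w' ⟨-, p', hp', hw'⟩
      exact (key x hx p' hp' w' hw').1
    · exact fun r hr => (hG' z hz r hr).imp fun _ => And.right
  · rintro y ⟨-, z, ⟨-, w, ⟨-, p, hp, hw⟩, hz⟩, -, q, hq, hy⟩
    obtain ⟨y', hy', hname⟩ := (key x hx p hp w hw).2 z hz q hq
    obtain rfl := f.outRep.unique _ _ _ hy hname
    exact hy'

theorem ReducesVia.trans {f g h : Problem} {F G F' G' : (ℕ → ℕ) → ℕ → ℕ}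
    (hfg : ReducesVia f g F G) (hgh : ReducesVia g h F' G') :
    ReducesVia f h (fun p => F' (F p)) (fun q => G (G' q)) := by
  intro p x hp hx
  obtain ⟨w, hw, hwdom, hG⟩ := hfg p x hp hx
  obtain ⟨v, hv, hvdom, hG'⟩ := hgh _ w hw hwdom
  refine ⟨v, hv, hvdom, fun z hz q hq => ?_⟩
  obtain ⟨y, hy, hyname⟩ := hG' z hz q hq
  exact hG y hy _ hyname

/-- A jump changes only the input representation, so `G` stays and `F` is applied to each row of the
converging sequence. -/
theorem ReducesVia.iterJump {f g : Problem} {F G : (ℕ → ℕ) → ℕ → ℕ} (h : ReducesVia f g F G)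
    (hF : Finitary F) (m : ℕ) :
    ∃ F', Finitary F' ∧ ReducesVia (f.iterJump m) (g.iterJump m) F' G := by
  induction m with
  | zero => exact ⟨F, hF, h⟩
  | succ m ih =>
    obtain ⟨F', hF', h'⟩ := ih
    refine ⟨_, hF'.pointwise, ?_⟩
    rw [Problem.iterJump_succ, Problem.iterJump_succ]
    rintro p x ⟨q, hpq, hq⟩ hx
    obtain ⟨w, hw, hw'⟩ := h' q x hq hx
    exact ⟨w, ⟨_, hF'.isLim hpq, hw⟩, hw'⟩

/-- Splits off the innermost jump, so that a reduction between `C₂'` and `BWT₂` can be lifted. -/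
theorem Problem.iterJump_succ' (f : Problem) (m : ℕ) :
    f.iterJump (m + 1) = f.jump.iterJump m :=
  rfl

/-! ### Choice and the Bolzano-Weierstrass problem -/

theorem mem_BWT_sol {k : ℕ} {x : ℕ → Fin k} {a : Fin k} :
    a ∈ (BWT k).sol x ↔ ∃ᶠ i in atTop, x i = a := by
  change MapClusterPt a atTop x ↔ _
  rw [mapClusterPt_iff_frequently]
  refine ⟨fun h => h {a} (by simp), fun h s hs => h.mono fun i hi => ?_⟩
  rw [hi]
  exact mem_of_mem_nhds hs

/-- Pigeonhole: if every color were eventually avoided, some entry would avoid all colors, its own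
included. -/
theorem BWT_sol_nonempty {k : ℕ} (x : ℕ → Fin k) : ((BWT k).sol x).Nonempty := by
  by_contra h
  have h' : ∀ a : Fin k, ∀ᶠ i in atTop, x i ≠ a := fun a => by
    rw [← not_frequently, ← mem_BWT_sol]
    exact fun ha => h ⟨a, ha⟩
  obtain ⟨i, hi⟩ := (eventually_all.mpr h').exists
  exact hi _ rfl

/-- The forward map of `C₂' ≤ BWT₂`: at stage `s`, choose the point whose exclusion is found later
among the first `s + 1` entries of the current approximation. -/
def choiceToBWT (p : ℕ → ℕ) (s : ℕ) : ℕ :=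
  let l := (List.range (s + 1)).map fun k => p (cantorPair s k)
  -- The entry `2` excludes the point `1`, and `1` excludes `0`. A missing entry has index
  -- `l.length`, so a tie means that neither has been found.
  if l.idxOf 2 ≤ l.idxOf 1 then 0 else 1

theorem finitary_choiceToBWT : Finitary choiceToBWT := by
  have hl : Primrec fun x : ℕ × List ℕ =>
      (List.range (x.1 + 1)).map fun k => x.2.getD (cantorPair x.1 k) 0 :=
    Primrec.list_map (Primrec.list_range.comp (Primrec.succ.comp Primrec.fst))
      ((Primrec.list_getD 0).comp (Primrec.snd.comp Primrec.fst)
        (primrec_cantorPair.comp (Primrec.fst.comp Primrec.fst) Primrec.snd)).to₂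
  refine ⟨fun s => cantorPair s (s + 1), fun s l =>
      if ((List.range (s + 1)).map fun k => l.getD (cantorPair s k) 0).idxOf 2 ≤
        ((List.range (s + 1)).map fun k => l.getD (cantorPair s k) 0).idxOf 1 then 0 else 1,
    primrec_cantorPair.comp Primrec.id Primrec.succ, ?_, fun p s => ?_⟩
  · exact Primrec.ite (Primrec.nat_le.comp (Primrec.list_idxOf.comp (Primrec.const 2) hl)
      (Primrec.list_idxOf.comp (Primrec.const 1) hl)) (Primrec.const 0) (Primrec.const 1)
  · have : (List.range (s + 1)).map (fun k => p (cantorPair s k)) =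
        (List.range (s + 1)).map fun k =>
          ((List.range (cantorPair s (s + 1))).map p).getD (cantorPair s k) 0 := by
      refine List.map_congr_left fun k hk => ?_
      have := cantorPair_lt_cantorPair s (List.mem_range.mp hk)
      simp [List.getD, this]
    simp only [choiceToBWT, this]

theorem idxOf_map_range_le {p : ℕ → ℕ} {v i : ℕ} (s : ℕ) (h : p i = v) :
    ((List.range (s + 1)).map p).idxOf v ≤ i := by
  by_contra! hlt
  have := List.not_of_lt_findIdx (p := (· == v)) hlt
  simp [h] at this

theorem lt_idxOf_map_range {p : ℕ → ℕ} {v i s : ℕ} (hi : i ≤ s) (h : ∀ j ≤ i, p j ≠ v) :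
    i < ((List.range (s + 1)).map p).idxOf v := by
  by_contra! hle
  have hlen : ((List.range (s + 1)).map p).idxOf v < ((List.range (s + 1)).map p).length := by
    simp only [List.length_map, List.length_range]; omega
  have := List.getElem_idxOf hlen
  simp only [List.getElem_map, List.getElem_range] at this
  exact h _ hle this

/-- If `u` occurs in the limit and `v` does not, then `u` is eventually found first. -/
theorem eventually_idxOf_lt {p q : ℕ → ℕ} (h : IsLim p q) {u v : ℕ} (hu : ∃ i, q i = u)
    (hv : ∀ i, q i ≠ v) : ∀ᶠ s in atTop,
      ((List.range (s + 1)).map fun k => p (cantorPair s k)).idxOf u <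
        ((List.range (s + 1)).map fun k => p (cantorPair s k)).idxOf v := by
  obtain ⟨i, hi⟩ := hu
  have h' : ∀ᶠ s in atTop, ∀ k ∈ Finset.range (i + 1), p (cantorPair s k) = q k :=
    (eventually_all_finset _).mpr fun k _ => isLim_iff.mp h k
  filter_upwards [h', eventually_ge_atTop i] with s hs his
  have hs' : ∀ k ≤ i, p (cantorPair s k) = q k := fun k hk => hs k (by simp; omega)
  exact (idxOf_map_range_le (p := fun k => p (cantorPair s k)) s ((hs' i le_rfl).trans hi)).trans_lt
    (lt_idxOf_map_range his fun j hj => by rw [hs' j hj]; exact hv j)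

theorem choice_jump_reducesVia_BWT :
    ReducesVia (choice 2).jump (BWT 2) choiceToBWT fun q => q := by
  rintro p (A : Set (Fin 2)) ⟨q, hpq, hq⟩ hA
  have hlt : ∀ s, choiceToBWT p s < 2 := fun s => by
    simp only [choiceToBWT]; split_ifs <;> norm_num
  refine ⟨fun s => ⟨choiceToBWT p s, hlt s⟩, fun s => rfl, BWT_sol_nonempty _, ?_⟩
  intro (a : Fin 2) ha r hr
  refine ⟨a, show a ∈ A from ?_, hr⟩
  replace ha := mem_BWT_sol.mp ha
  by_contra hna
  have ha' := (hq a).mp hna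
  obtain ⟨b, hb⟩ : A.Nonempty := hA
  have hb' : ∀ i, q i ≠ b + 1 := fun i hi => (hq b).mpr ⟨i, hi⟩ hb
  -- A frequent event fails once its negation holds eventually: it suffices that `a` is output only
  -- finitely often.
  refine ha ?_
  filter_upwards [eventually_idxOf_lt hpq ha' hb'] with s hs hxs
  have hval : choiceToBWT p s = a := congrArg Fin.val hxs
  have hab : a ≠ b := fun h => hna (h ▸ hb)
  simp only [choiceToBWT] at hval
  fin_cases a <;> fin_cases b <;> simp at hab hs hval <;> omega

/-- The forward map of `BWT₂ ≤ C₂'`: at stage `s`, the entry `2 * N + a` excludes the point `a` if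
it does not occur between `N` and `s`. -/
def BWTToChoice (p : ℕ → ℕ) (z : ℕ) : ℕ :=
  let w := (cantorUnpair z).2
  -- For stages before `w / 2` this list is empty and the point is excluded provisionally; only the
  -- limit matters.
  let l := ((List.range ((cantorUnpair z).1 + 1)).map p).drop (w / 2)
  if l.idxOf (w % 2) < l.length then 0 else w % 2 + 1

theorem finitary_BWTToChoice : Finitary BWTToChoice := by
  have hw : Primrec fun x : ℕ × List ℕ => (cantorUnpair x.1).2 :=
    Primrec.snd.comp (primrec_cantorUnpair.comp Primrec.fst)
  have hl : Primrec fun x : ℕ × List ℕ => x.2.drop ((cantorUnpair x.1).2 / 2) :=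
    Primrec.list_drop.comp (Primrec.nat_div.comp hw (Primrec.const 2)) Primrec.snd
  have hmod : Primrec fun x : ℕ × List ℕ => (cantorUnpair x.1).2 % 2 :=
    Primrec.nat_mod.comp hw (Primrec.const 2)
  refine ⟨fun z => (cantorUnpair z).1 + 1, fun z l =>
      if (l.drop ((cantorUnpair z).2 / 2)).idxOf ((cantorUnpair z).2 % 2) <
        (l.drop ((cantorUnpair z).2 / 2)).length then 0 else (cantorUnpair z).2 % 2 + 1,
    Primrec.succ.comp (Primrec.fst.comp primrec_cantorUnpair), ?_, fun p z => rfl⟩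
  exact Primrec.ite (Primrec.nat_lt.comp (Primrec.list_idxOf.comp hmod hl)
    (Primrec.list_length.comp hl)) (Primrec.const 0) (Primrec.succ.comp hmod)

open Classical in
theorem BWTToChoice_cantorPair (p : ℕ → ℕ) (s w : ℕ) :
    BWTToChoice p (cantorPair s w) =
      if ∃ i, w / 2 ≤ i ∧ i ≤ s ∧ p i = w % 2 then 0 else w % 2 + 1 := by
  simp only [BWTToChoice, cantorUnpair_pair, List.idxOf_lt_length_iff]
  congr 1
  simp only [eq_iff_iff, List.mem_iff_getElem, List.getElem_drop, List.getElem_map,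
    List.getElem_range, List.length_drop, List.length_map, List.length_range]
  constructor
  · rintro ⟨i, hi, h⟩
    exact ⟨_, by omega, by omega, h⟩
  · rintro ⟨i, h₁, h₂, h⟩
    exact ⟨i - w / 2, by omega, by rw [← h]; congr 1; omega⟩

open Classical in
-- The set handed to choice is the set of cluster points itself, so nothing has to be translated
-- back. Entry `2 * N + a` of the limit excludes `a` exactly when `a` never occurs from `N` on.
theorem BWT_reducesVia_choice_jump :
    ReducesVia (BWT 2) (choice 2).jump BWTToChoice fun q => q := by
  intro p (x : ℕ → Fin 2) hp _
  have hp' : ∀ i, p i = x i := hp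
  refine ⟨(BWT 2).sol x, ⟨fun w => if ∃ i, w / 2 ≤ i ∧ p i = w % 2 then 0 else w % 2 + 1,
    ?_, fun a => ?_⟩, BWT_sol_nonempty x, fun a ha r hr => ⟨a, ha, hr⟩⟩
  · rw [isLim_iff]
    intro w
    by_cases h : ∃ i, w / 2 ≤ i ∧ p i = w % 2
    · obtain ⟨i, hi, hpi⟩ := h
      filter_upwards [eventually_ge_atTop i] with s hs
      rw [BWTToChoice_cantorPair, if_pos ⟨i, hi, hs, hpi⟩, if_pos ⟨i, hi, hpi⟩]
    · refine Eventually.of_forall fun s => ?_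
      rw [BWTToChoice_cantorPair, if_neg h,
        if_neg fun ⟨i, hi, _, hpi⟩ => h ⟨i, hi, hpi⟩]
  · refine (not_congr mem_BWT_sol).trans ?_
    rw [not_frequently, eventually_atTop]
    constructor
    · rintro ⟨N, hN⟩
      have ha := a.2
      have h₁ : (2 * N + (a : ℕ)) / 2 = N := by omega
      have h₂ : (2 * N + (a : ℕ)) % 2 = a := by omega
      refine ⟨2 * N + a, ?_⟩
      simp only [h₁, h₂]
      refine if_neg ?_
      rintro ⟨i, hi, hpi⟩
      exact hN i hi (Fin.ext ((hp' i).symm.trans hpi))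
    · rintro ⟨w, hw⟩
      dsimp only at hw
      split_ifs at hw with h
      refine ⟨w / 2, fun i hi hxi => h ⟨i, hi, ?_⟩⟩
      rw [hp', hxi]
      omega

/-! ### Coding finite sets by iterated pairing -/

/-- `[k, s₁, …, sₘ] ↦ ⟨sₘ, ⟨…, ⟨s₁, k⟩⟩⟩`. -/
def listCode : List ℕ → ℕ
  | [] => 0
  | k :: t => t.foldl (fun r s => cantorPair s r) k

theorem listCode_concat {l : List ℕ} (hl : l ≠ []) (i : ℕ) :
    listCode (l ++ [i]) = cantorPair i (listCode l) := by
  cases l with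
  | nil => exact absurd rfl hl
  | cons k t => simp [listCode]

theorem primrec_listCode : Primrec listCode := by
  have h : Primrec fun l : List ℕ => l.tail.foldl (fun r s => cantorPair s r) l.headI :=
    Primrec.list_foldl Primrec.list_tail Primrec.list_headI
      (primrec_cantorPair.comp (Primrec.snd.comp Primrec.snd)
        (Primrec.fst.comp Primrec.snd)).to₂
  refine h.of_eq fun l => ?_
  cases l <;> rfl

/-- The code of a finite set, listed in increasing order. -/
def setCode (A : Finset ℕ) : ℕ := listCode A.sort

theorem setCode_singleton (k : ℕ) : setCode {k} = k := by
  simp [setCode, listCode]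

/-- A new maximum comes last in the sorted list, hence becomes the outermost coordinate, which is
the index of the limit in `IsLim`. A singleton is coded without pairing, so `A` must be nonempty. -/
theorem setCode_insert {A : Finset ℕ} (hA : A.Nonempty) {i : ℕ} (hi : ∀ k ∈ A, k < i) :
    setCode (insert i A) = cantorPair i (setCode A) := by
  have h : (insert i A).sort = A.sort ++ [i] := by
    refine (Finset.sortedLT_sort _).eq_of_mem_iff ?_ fun a => by simp [or_comm]
    rw [List.sortedLT_iff_pairwise, List.pairwise_append]
    exact ⟨(Finset.sortedLT_sort A).pairwise, by simp, by simpa using hi⟩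
  rw [setCode, h, listCode_concat, setCode]
  intro h0
  have := congrArg List.length h0
  rw [Finset.length_sort] at this
  exact hA.card_ne_zero this

/-- The increasing list of the elements of `theta n z`. -/
def thetaList : ℕ → ℕ → List ℕ
  | 0, _ => []
  | 1, z => [z]
  | n + 2, z => (cantorUnpair z).1 ::
      (thetaList (n + 1) (cantorUnpair z).2).map (· + ((cantorUnpair z).1 + 1))

theorem primrec_thetaList : ∀ n, Primrec (thetaList n)
  | 0 => Primrec.const []
  | 1 => Primrec.list_cons.comp Primrec.id (Primrec.const [])
  | n + 2 => by
    have h₁ : Primrec fun z => (cantorUnpair z).1 := Primrec.fst.comp primrec_cantorUnpair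
    have h₂ : Primrec fun z => (cantorUnpair z).2 := Primrec.snd.comp primrec_cantorUnpair
    exact Primrec.list_cons.comp h₁ (Primrec.list_map ((primrec_thetaList (n + 1)).comp h₂)
      (Primrec.nat_add.comp Primrec.snd (Primrec.succ.comp (h₁.comp Primrec.fst))).to₂)

theorem mem_thetaList : ∀ n z a, a ∈ thetaList n z ↔ a ∈ theta n z
  | 0, _, _ => by simp [thetaList, theta]
  | 1, _, _ => by simp [thetaList, theta]
  | n + 2, z, a => by simp [thetaList, theta, mem_thetaList (n + 1)]

theorem pairwise_thetaList : ∀ n z, (thetaList n z).Pairwise (· < ·)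
  | 0, _ => by simp [thetaList]
  | 1, _ => by simp [thetaList]
  | n + 2, z => by
    rw [thetaList, List.pairwise_cons, List.pairwise_map]
    refine ⟨fun a ha => ?_, (pairwise_thetaList (n + 1) _).imp fun h => by omega⟩
    obtain ⟨b, -, rfl⟩ := List.mem_map.mp ha
    omega

/-- A strictly increasing list is determined by its elements; this replaces sorting by a primitive
recursive list. -/
theorem setCode_theta (n z : ℕ) : setCode (theta n z) = listCode (thetaList n z) := by
  rw [setCode]
  congr 1
  exact (Finset.sortedLT_sort _).eq_of_mem_iff (pairwise_thetaList n z).sortedLT fun a => by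
    simp [mem_thetaList]

/-! ### The Bolzano-Weierstrass problem and stable colorings -/

/-- A name in an iterated jump comes with the sequence of its iterated limits. -/
theorem exists_iterated_limits {X : Type} (δ : Representation X) (m : ℕ) {p : ℕ → ℕ} {x : X}
    (h : (Representation.jump^[m] δ).IsName p x) :
    ∃ q : ℕ → ℕ → ℕ, q m = p ∧ δ.IsName (q 0) x ∧ ∀ j < m, IsLim (q (j + 1)) (q j) := by
  induction m generalizing p with
  | zero => exact ⟨fun _ => p, rfl, h, by simp⟩
  | succ m ih =>
    rw [Function.iterate_succ_apply'] at h
    obtain ⟨r, hpr, hr⟩ := h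
    obtain ⟨q, hqm, hq0, hq⟩ := ih hr
    refine ⟨fun j => if j = m + 1 then p else q j, by simp, by simpa using hq0, fun j hj => ?_⟩
    rcases eq_or_lt_of_le (Nat.lt_succ_iff.mp hj) with rfl | hlt
    · simpa [hqm] using hpr
    · have h₁ : j ≠ m + 1 := by omega
      have h₂ : j ≠ m := by omega
      simpa [h₁, h₂] using hq j hlt

/-- Cut off at `1`, so as to have a color. -/
def toColor (r : ℕ) : Fin 2 := ⟨min r 1, by omega⟩

theorem toColor_val (a : Fin 2) : toColor a = a := by
  apply Fin.ext
  simp only [toColor]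
  omega

/-- The coloring `{k < s₁ < … < sₘ} ↦ p ⟨sₘ, ⟨…, ⟨s₁, k⟩⟩⟩`. -/
def nestedColoring (n : ℕ) (p : ℕ → ℕ) (A : NSubset n) : Fin 2 := toColor (p (setCode A.1))

/-- Adjoining an ever larger element to `A` amounts to running through the rows of `p` at the fixed
position `setCode A`. -/
theorem eventually_setCode_insert {p q : ℕ → ℕ} (h : IsLim p q) {A : Finset ℕ}
    (hA : A.Nonempty) : ∀ᶠ i in atTop, p (setCode (insert i A)) = q (setCode A) := by
  filter_upwards [isLim_iff.mp h (setCode A), eventually_gt_atTop (A.sup id)] with i hi hlt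
  rw [setCode_insert hA fun k hk => (Finset.le_sup (f := id) hk).trans_lt hlt, hi]

theorem isStable_nestedColoring {n : ℕ} (hn : 2 ≤ n) {p q : ℕ → ℕ} (h : IsLim p q) :
    IsStable (nestedColoring n p) := by
  intro A hA
  refine ⟨toColor (q (setCode A)), ?_⟩
  filter_upwards [eventually_setCode_insert h (Finset.card_pos.mp (by omega : 0 < A.card))]
    with i hi _
  simp only [nestedColoring, hi]

/-- Every color that is taken by the iterated limit infinitely often is the color of an infinite
homogeneous set. -/
theorem exists_homogeneous {m : ℕ} {q : ℕ → ℕ → ℕ} (hq : ∀ j < m, IsLim (q (j + 1)) (q j))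
    {a : Fin 2} (ha : ∃ᶠ i in atTop, toColor (q 0 i) = a) :
    ∃ M, IsHomogeneousOfColor (nestedColoring (m + 1) (q m)) a M := by
  -- Sets of every size up to `m + 1` are controlled, those of size `j + 1` by the level `q j`; this
  -- makes the condition inductive when an element is added.
  let Good (A : Finset ℕ) : Prop := ∀ j ≤ m, A.card = j + 1 → toColor (q j (setCode A)) = a
  let 𝓕 : Set (Set ℕ) := {M | ∀ A : Finset ℕ, (A : Set ℕ) ⊆ M → Good A}
  -- The condition speaks only of finite subsets, so a maximal `M` exists. It remains to see that a
  -- finite `M` can be enlarged.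
  have h𝓕 : Order.IsOfFiniteCharacter 𝓕 := fun M =>
    ⟨fun hM N hN _ A hA => hM A (hA.trans hN),
      fun hM A hA => hM A hA A.finite_toSet A subset_rfl⟩
  have hempty : (∅ : Set ℕ) ∈ 𝓕 := fun A hA j _ hcard => by
    rw [Set.subset_empty_iff, Finset.coe_eq_empty] at hA
    simp [hA] at hcard
  obtain ⟨M, -, hM, hmax⟩ := h𝓕.exists_maximal hempty
  refine ⟨M, fun hfin => ?_, fun A hA => hM A.1 hA m le_rfl A.2⟩
  -- A finite `M` has finitely many subsets, so one threshold serves all the limits involved.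
  have hev : ∀ᶠ i in atTop, ∀ A ∈ hfin.toFinset.powerset, ∀ j, j < m → A.card = j + 1 →
      q (j + 1) (setCode (insert i A)) = q j (setCode A) := by
    rw [eventually_all_finset]
    intro A _
    by_cases hj : ∃ j, j < m ∧ A.card = j + 1
    · obtain ⟨j, hjm, hcard⟩ := hj
      filter_upwards [eventually_setCode_insert (hq j hjm)
        (Finset.card_pos.mp (by omega : 0 < A.card))]
        with i hi j' _ hcard'
      obtain rfl : j' = j := by omega
      exact hi
    · exact Eventually.of_forall fun i j hjm hcard => absurd ⟨j, hjm, hcard⟩ hj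
  have hgt : ∀ᶠ i in atTop, i ∉ M := by
    filter_upwards [eventually_gt_atTop (hfin.toFinset.sup id)] with i hi hiM
    exact absurd (Finset.le_sup (f := id) (hfin.mem_toFinset.mpr hiM)) (not_le.mpr hi)
  obtain ⟨i, hia, hi, hiM⟩ := (ha.and_eventually (hev.and hgt)).exists
  refine hiM (hmax (y := insert i M) ?_ (Set.subset_insert i M) (Set.mem_insert i M))
  intro B hB j hj hcard
  -- If `B = {i}`, the color is right by the choice of `i`. If `B` is larger and contains `i`, the
  -- limit has been reached and the color is that of `B.erase i` one level down.
  by_cases hiB : i ∈ B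
  · have hsub : ((B.erase i : Finset ℕ) : Set ℕ) ⊆ M := by
      intro k hk
      obtain ⟨hne, hkB⟩ := Finset.mem_erase.mp (Finset.mem_coe.mp hk)
      exact (hB hkB).resolve_left hne
    have hc := Finset.card_erase_of_mem hiB
    cases j with
    | zero =>
      obtain ⟨k, rfl⟩ := Finset.card_eq_one.mp hcard
      obtain rfl := Finset.mem_singleton.mp hiB
      rwa [setCode_singleton]
    | succ j =>
      have := hi (B.erase i) (by rw [Finset.mem_powerset, Set.Finite.subset_toFinset]; exact hsub)
        j (by omega) (by omega)
      rw [Finset.insert_erase hiB] at this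
      rw [this]
      exact hM _ hsub j (by omega) (by omega)
  · exact hM B (fun k hk => (hB hk).resolve_left fun h => hiB (h ▸ hk)) j hj hcard

/-- The color of an infinite homogeneous set is the color of the iterated limit on that set. -/
theorem toColor_of_homogeneous {m : ℕ} {q : ℕ → ℕ → ℕ} (hq : ∀ j < m, IsLim (q (j + 1)) (q j))
    {a : Fin 2} {M : Set ℕ} (hM : IsHomogeneousOfColor (nestedColoring (m + 1) (q m)) a M) :
    ∀ k ∈ M, toColor (q 0 k) = a := by
  induction m with
  | zero =>
    intro k hk
    have := hM.2 ⟨{k}, rfl⟩ (by simpa using hk)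
    simpa [nestedColoring, setCode_singleton] using this
  | succ m ih =>
    refine ih (fun j hj => hq j (by omega)) ⟨hM.1, fun ⟨A, hcard⟩ hA => ?_⟩
    have hev := eventually_setCode_insert (hq m (by omega))
      (Finset.card_pos.mp (by omega : 0 < A.card))
    -- As `M` is infinite, it has an element beyond `A` at which the limit has been reached. So `M`
    -- is homogeneous, with the same color, one level down.
    obtain ⟨i, hiM, hi, hlt⟩ := ((Nat.frequently_atTop_iff_infinite.mpr hM.1).and_eventually
      (hev.and (eventually_gt_atTop (A.sup id)))).exists
    have hiA : i ∉ A := fun h => absurd (Finset.le_sup (f := id) h) (not_le.mpr hlt)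
    have := hM.2 ⟨insert i A, by rw [Finset.card_insert_of_notMem hiA, hcard]⟩ (by
      rw [Finset.coe_insert]
      exact Set.insert_subset hiM hA)
    simpa only [nestedColoring, hi] using this

/-- The forward map of `BWT₂^(n-1) ≤ CSRT_{n,2}`. -/
def BWTToCSRT (n : ℕ) (p : ℕ → ℕ) (z : ℕ) : ℕ := min (p (listCode (thetaList n z))) 1

theorem finitary_BWTToCSRT (n : ℕ) : Finitary (BWTToCSRT n) := by
  have h : Primrec fun z => listCode (thetaList n z) :=
    primrec_listCode.comp (primrec_thetaList n)
  refine ⟨fun z => listCode (thetaList n z) + 1,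
    fun z l => min (l.getD (listCode (thetaList n z)) 0) 1, Primrec.succ.comp h, ?_,
    fun p z => ?_⟩
  · exact Primrec.nat_min.comp ((Primrec.list_getD 0).comp Primrec.snd (h.comp Primrec.fst))
      (Primrec.const 1)
  · simp [BWTToCSRT, List.getD]

/-- The backward map keeps the even entries, where the product representation stores the color; the
set `M` is discarded. -/
theorem BWT_reducesVia_CSRT (m : ℕ) :
    ReducesVia ((BWT 2).iterJump (m + 1)) (CSRT (m + 2) 2) (BWTToCSRT (m + 2))
      fun r n => r (2 * n) := by
  intro p (x : ℕ → Fin 2) hp _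
  obtain ⟨q, rfl, hq0, hq⟩ := exists_iterated_limits (finSeqRep 2) (m + 1) hp
  have hx : ∀ i, toColor (q 0 i) = x i := fun i => by
    rw [show q 0 i = x i from hq0 i, toColor_val]
  have hstable : IsStable (nestedColoring (m + 2) (q (m + 1))) :=
    isStable_nestedColoring (by omega) (hq m (by omega))
  refine ⟨nestedColoring (m + 2) (q (m + 1)), fun z => ?_, ?_, ?_⟩
  · simp [BWTToCSRT, nestedColoring, toColor, setCode_theta]
  · obtain ⟨a, ha⟩ := BWT_sol_nonempty x
    replace ha := mem_BWT_sol.mp ha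
    -- This puts the coloring in the domain of `CSRT`: any cluster point is the color of some
    -- homogeneous set.
    obtain ⟨M, hM⟩ := exists_homogeneous hq (a := a) (by simpa only [hx] using ha)
    exact ⟨(a, M), hstable, hM⟩
  · rintro ⟨a, M⟩ ⟨-, hM⟩ r ⟨hr, -⟩
    refine ⟨a, mem_BWT_sol.mpr ?_, hr⟩
    refine (Nat.frequently_atTop_iff_infinite.mpr hM.1).mono fun k hk => ?_
    rw [← hx]
    exact toColor_of_homogeneous hq hM k hk

end Weihrauch

theorem theorem3p5 (n : ℕ) (hn : 2 ≤ n) :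
    Weihrauch.StrongEquiv
      ((Weihrauch.choice 2).iterJump n) ((Weihrauch.BWT 2).iterJump (n - 1)) ∧
    Weihrauch.StrongLE ((Weihrauch.BWT 2).iterJump (n - 1)) (Weihrauch.CSRT n 2) ∧
    Weihrauch.StrongLE ((Weihrauch.choice 2).iterJump n) (Weihrauch.CSRT n 2) := by
  open Weihrauch in
  obtain ⟨m, rfl⟩ : ∃ m, n = m + 2 := ⟨n - 2, by omega⟩
  rw [show m + 2 - 1 = m + 1 from rfl, Problem.iterJump_succ']
  obtain ⟨F₁, hF₁, h₁⟩ := choice_jump_reducesVia_BWT.iterJump finitary_choiceToBWT (m + 1)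
  obtain ⟨F₂, hF₂, h₂⟩ := BWT_reducesVia_choice_jump.iterJump finitary_BWTToChoice (m + 1)
  have h₃ := BWT_reducesVia_CSRT m
  have hF₃ := (finitary_BWTToCSRT (m + 2)).totalRecursive
  have hid : TotalRecursive fun q n => q n := TotalRecursive.oracle
  have heven : TotalRecursive fun q n => q (2 * n) :=
    hid.comp (TotalRecursive.of_primrec (Primrec.nat_mul.comp (Primrec.const 2) Primrec.id))
  exact ⟨⟨h₁.strongLE hF₁.totalRecursive hid, h₂.strongLE hF₂.totalRecursive hid⟩,
    h₃.strongLE hF₃ heven,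
    (h₁.trans h₃).strongLE (hF₃.subst hF₁.totalRecursive) heven⟩
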